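/- Let $\Gamma$ be a finite tree with vertex set $\mathcal V$ (all vertices rational) with integral Euler decorations and negative definite intersection form, let $L=\mathbb Z^{\mathcal V}=\mathbb Z\langle E_i\rangle_{i\in\mathcal V}$ be its lattice with intersection form $(\,,\,)$, where $(E_i,E_i)$ is the decoration of $i$ and, for $i\neq j$, $(E_i,E_j)$ is $1$ or $0$ according to whether $i,j$ are joined by an edge. Let $L'=\{l'\in L\otimes\mathbb Q : (l',L)\subset\mathbb Z\}$ and $\mathcal S'=\{l'\in L' : (l',E_i)\le 0 \text{ for all } i\}$. Fix $h\in L'/L$ and $s\in\mathcal S'\setminus\{0\}$. Let $s_h$ be the (coordinatewise) smallest element of $\mathcal S'$ with class $h$, let $Z_K\in L\otimes\mathbb Q$ be given by $(Z_K,E_i)=(E_i,E_i)+2$ for all $i$, and put $k_h=-Z_K+2s_h$ and $\chi_h(l)=-\tfrac12(l,l+k_h)$ for $l\in L$. For $l\in L$ and $I\subset\mathcal V$ let $(l,I)\subset\mathbb R^{\mathcal V}$ be the cube with vertices $l+\sum_{j\in J}E_j$, $J\subset I$, and let its weight be the maximum of $\chi_h$ on these vertices. For $n\in\mathbb Z$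 let $S_n\subset\mathfrak X=(\mathbb R_{\ge0})^{\mathcal V}$ be the intersection of $\mathfrak X$ with the union of all cubes of weight at most $n$. For $d\ge 0$ let $\mathfrak X_{-d}$ be the union of the cubes $(l,I)$ with $l\in(\mathbb Z_{\ge 0})^{\mathcal V}$ and $(s,l)\le -d$. For each $n$ let $(E^k_{-d,q})_n$ ($k\ge1$, $d\ge 0$, $q\in\mathbb Z$) be the pages of the homological spectral sequence of the singular chain complex (over $\mathbb Z$) of $S_n$ filtered by the chains of the subspaces $S_n\cap\mathfrak X_{-d}$; thus $(E^1_{-d,q})_n=H_{-d+q}(S_n\cap\mathfrak X_{-d},\,S_n\cap\mathfrak X_{-d-1};\mathbb Z)$. The inclusions $S_n\subset S_{n+1}$ respect the filtrations and induce maps $U:(E^k_{-d,q})_n\to(E^k_{-d,q})_{n+1}$, which make $(E^k_{*,*})_*=\bigoplus_{n,d,q}(E^k_{-d,q})_n$ a triple graded $\mathbb Z[U]$-module. Then for every $n\in\mathbb Z$ there is an integer $\delta(n)>0$ such that for all $d\ge0$ and $q$ the map $$U^{\delta(n)}:(E^1_{-d,q})_n\to(E^1_{-d,q})_{n+\delta(n)}$$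 is zero. Moreover, with the same $\delta(n)$, the map $U^{\delta(n)}:(E^k_{-d,q})_n\to(E^k_{-d,q})_{n+\delta(n)}$ is zero for all $k\ge1$, $d\ge 0$ and $q$. Consequently, for every $k\ge1$, $(E^k_{*,*})_*$ is a torsion $\mathbb Z[U]$-module. -/

import Mathlib

open CategoryTheory AlgebraicTopology

noncomputable section

namespace FilteredLattice

/-! ### The lattice of a resolution graph -/

open Classical in
/-- The intersection matrix of a decorated graph: Euler numbers on the diagonal, and off the diagonal
`1` for every edge. -/
def plumbingMatrix {V : Type} (G : SimpleGraph V) (e : V → ℤ) : Matrix V V ℚ :=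
  fun i j => if i = j then (e i : ℚ) else if G.Adj i j then 1 else 0

/-- A connected negative definite plumbing graph whose plumbed manifold is a rational homology
sphere: a finite tree of rational vertices, decorated by Euler numbers, with negative definite
intersection form. -/
structure ResolutionGraph (V : Type) [Fintype V] [DecidableEq V] where
  graph : SimpleGraph V
  isTree : graph.IsTree
  euler : V → ℤ
  negDef : ∀ x : V → ℚ, x ≠ 0 → Matrix.toBilin' (plumbingMatrix graph euler) x x < 0

variable {V : Type} [Fintype V] [DecidableEq V]

namespace ResolutionGraph

variable (Γ : ResolutionGraph V)

/-- The intersection matrix `(E_i, E_j)`. -/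
def matrix : Matrix V V ℚ := plumbingMatrix Γ.graph Γ.euler

/-- The intersection form on `L ⊗ ℚ = ℚ^V`, where `L = ℤ^V`. -/
def form : LinearMap.BilinForm ℚ (V → ℚ) := Matrix.toBilin' Γ.matrix

/-- The base element `E_i`, in `L ⊗ ℚ`. -/
def base (i : V) : V → ℚ := Pi.single i 1

/-- The inclusion of `L = ℤ^V` into `L ⊗ ℚ`. -/
def incl : (V → ℤ) →+ (V → ℚ) where
  toFun l i := l i
  map_zero' := by ext; simp
  map_add' _ _ := by ext; simp

/-- The dual lattice `L' = {x ∈ L ⊗ ℚ : (x, l) ∈ ℤ for all l ∈ L}`. -/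
def dualLattice : AddSubgroup (V → ℚ) where
  carrier := {x | ∀ l : V → ℤ, ∃ m : ℤ, Γ.form x (incl l) = m}
  zero_mem' l := ⟨0, by simp⟩
  add_mem' {x y} hx hy l := by
    obtain ⟨a, ha⟩ := hx l
    obtain ⟨b, hb⟩ := hy l
    exact ⟨a + b, by simp [ha, hb]⟩
  neg_mem' {x} hx l := by
    obtain ⟨a, ha⟩ := hx l
    exact ⟨-a, by simp [ha]⟩

/-- The lattice `L` as a subgroup of `L'`. -/
def lattice : AddSubgroup Γ.dualLattice := (incl (V := V)).range.addSubgroupOf Γ.dualLattice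

/-- `H = L' / L`. -/
abbrev discriminant : Type := Γ.dualLattice ⧸ Γ.lattice

/-- The Lipman cone `𝒮' = {x ∈ L' : (x, E_i) ≤ 0 for all i}`. -/
def lipmanCone : Set Γ.dualLattice := {x | ∀ i, Γ.form x (base i) ≤ 0}

/-! ### The minimal representatives `s_h` exist -/

lemma form_apply (x y : V → ℚ) : Γ.form x y = ∑ i, ∑ j, x i * Γ.matrix i j * y j :=
  Matrix.toBilin'_apply _ _ _

lemma form_base (x : V → ℚ) (i : V) : Γ.form x (base i) = ∑ j, x j * Γ.matrix j i := by
  simp [form_apply, base, Pi.single_apply]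

lemma form_eq_sum (x y : V → ℚ) : Γ.form x y = ∑ i, y i * Γ.form x (base i) := by
  simp only [form_base, Finset.mul_sum]
  rw [form_apply, Finset.sum_comm]
  exact Finset.sum_congr rfl fun i _ => Finset.sum_congr rfl fun j _ => by ring

lemma matrix_nonneg {i j : V} (h : i ≠ j) : 0 ≤ Γ.matrix i j := by
  simp only [matrix, plumbingMatrix, if_neg h]
  split_ifs <;> simp

lemma matrix_symm (i j : V) : Γ.matrix i j = Γ.matrix j i := by
  by_cases h : i = j
  · simp [h]
  · simp only [matrix, plumbingMatrix, if_neg h, if_neg (Ne.symm h)]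
    by_cases ha : Γ.graph.Adj i j
    · rw [if_pos ha, if_pos ha.symm]
    · rw [if_neg ha, if_neg fun hb => ha hb.symm]

lemma matrix_int (i j : V) : ∃ m : ℤ, Γ.matrix i j = m := by
  simp only [matrix, plumbingMatrix]
  split_ifs
  · exact ⟨_, rfl⟩
  · exact ⟨1, by simp⟩
  · exact ⟨0, by simp⟩

lemma incl_mem (l : V → ℤ) : incl l ∈ Γ.dualLattice := by
  intro l'
  choose m hm using Γ.matrix_int
  exact ⟨∑ i, ∑ j, l i * m i j * l' j, by simp [form_apply, incl, hm]⟩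

lemma isUnit_det : IsUnit Γ.matrix.det := by
  rw [isUnit_iff_ne_zero]
  intro h0
  obtain ⟨v, hv, hv0⟩ := Matrix.exists_mulVec_eq_zero_iff.mpr h0
  have := Γ.negDef v hv
  rw [Matrix.toBilin'_apply'] at this
  change v ⬝ᵥ (Γ.matrix.mulVec v) < 0 at this
  simp [hv0] at this

/-- The vector `x` with `(x, E_i) = c_i` for all `i`. -/
def solve (c : V → ℚ) : V → ℚ := Γ.matrix⁻¹.mulVec c

lemma form_solve (c : V → ℚ) (i : V) : Γ.form (Γ.solve c) (base i) = c i := by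
  have h : Γ.matrix.mulVec (Γ.solve c) = c := by
    rw [solve, Matrix.mulVec_mulVec, Matrix.mul_nonsing_inv _ Γ.isUnit_det, Matrix.one_mulVec]
  rw [form_base]
  conv_rhs => rw [← h]
  simp only [Matrix.mulVec, dotProduct]
  exact Finset.sum_congr rfl fun j _ => by rw [Γ.matrix_symm j i, mul_comm]

lemma nonneg_of_antinef {x : V → ℚ} (hx : ∀ i, Γ.form x (base i) ≤ 0) : 0 ≤ x := by
  by_contra hneg
  set p : V → ℚ := fun i => max (x i) 0
  set m : V → ℚ := fun i => max (-x i) 0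
  have hxpm : x = p - m := by
    ext i
    simp only [p, m, Pi.sub_apply]
    rcases le_total (x i) 0 with h | h
    · rw [max_eq_right h, max_eq_left (by linarith)]; ring
    · rw [max_eq_left h, max_eq_right (by linarith)]; ring
  have hm0 : m ≠ 0 := by
    intro h0
    apply hneg
    intro i
    have := congrFun h0 i
    simp only [m, Pi.zero_apply, max_eq_right_iff] at this
    simp only [Pi.zero_apply]
    linarith
  have hmm : Γ.form m m < 0 := Γ.negDef m hm0
  have hpm : 0 ≤ Γ.form p m := by
    rw [form_apply]
    refine Finset.sum_nonneg fun i _ => Finset.sum_nonneg fun j _ => ?_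
    by_cases hij : i = j
    · subst hij
      have : p i * m i = 0 := by
        simp only [p, m]
        rcases le_total (x i) 0 with h | h
        · rw [max_eq_right h, zero_mul]
        · rw [max_eq_right (a := -x i) (by linarith), mul_zero]
      rw [mul_right_comm, this, zero_mul]
    · exact mul_nonneg (mul_nonneg (le_max_right _ _) (Γ.matrix_nonneg hij)) (le_max_right _ _)
  have hxm : Γ.form x m ≤ 0 := by
    rw [form_eq_sum]
    exact Finset.sum_nonpos fun i _ => mul_nonpos_of_nonneg_of_nonpos (le_max_right _ _) (hx i)
  have : Γ.form x m = Γ.form p m - Γ.form m m := by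
    conv_lhs => rw [hxpm]
    simp
  linarith

lemma antinef_inf_aux {x y : V → ℚ} (hx : ∀ i, Γ.form x (base i) ≤ 0) (i : V)
    (hi : x i ≤ y i) : Γ.form (x ⊓ y) (base i) ≤ 0 := by
  refine le_trans ?_ (hx i)
  rw [form_base, form_base]
  refine Finset.sum_le_sum fun j _ => ?_
  by_cases hij : j = i
  · subst hij
    simp [hi]
  · exact mul_le_mul_of_nonneg_right inf_le_left (Γ.matrix_nonneg hij)

lemma antinef_inf {x y : V → ℚ} (hx : ∀ i, Γ.form x (base i) ≤ 0)
    (hy : ∀ i, Γ.form y (base i) ≤ 0) (i : V) : Γ.form (x ⊓ y) (base i) ≤ 0 := by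
  rcases le_total (x i) (y i) with h | h
  · exact Γ.antinef_inf_aux hx i h
  · rw [inf_comm]
    exact Γ.antinef_inf_aux hy i h

lemma exists_antinef (x : V → ℚ) : ∃ l : V → ℤ, ∀ i, Γ.form (x + incl l) (base i) ≤ 0 := by
  obtain ⟨b, hb⟩ := IsLocalization.exist_integer_multiples_of_finite (nonZeroDivisors ℤ)
    (Γ.solve fun _ => -1)
  choose z hz using hb
  obtain ⟨N, hN⟩ := exists_nat_ge (∑ i, |Γ.form x (base i)|)
  have hb0 : (b : ℤ) ≠ 0 := nonZeroDivisors.coe_ne_zero b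
  refine ⟨fun i => N * (b * z i), fun i => ?_⟩
  have hl : incl (fun i => (N : ℤ) * (b * z i)) =
      ((N : ℚ) * ((b : ℤ) : ℚ) ^ 2) • Γ.solve (fun _ => -1) := by
    ext j
    have := hz j
    simp only [algebraMap_int_eq, eq_intCast, Algebra.smul_def] at this
    simp only [incl, AddMonoidHom.coe_mk, ZeroHom.coe_mk, Int.cast_mul, Int.cast_natCast, this,
      Pi.smul_apply, smul_eq_mul]
    ring
  rw [hl, map_add, LinearMap.add_apply, map_smul, LinearMap.smul_apply, form_solve, smul_eq_mul]
  have h1 : Γ.form x (base i) ≤ N := le_trans (le_abs_self _)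
    (le_trans (Finset.single_le_sum (f := fun i => |Γ.form x (base i)|)
      (fun _ _ => abs_nonneg _) (Finset.mem_univ i)) hN)
  have h2 : (1 : ℚ) ≤ ((b : ℤ) : ℚ) ^ 2 := by
    have : (1 : ℤ) ≤ (b : ℤ) ^ 2 := Int.add_one_le_iff.mpr (sq_pos_of_ne_zero hb0)
    exact_mod_cast this
  have h3 : (0 : ℚ) ≤ N := Nat.cast_nonneg N
  nlinarith

lemma exists_isLeast (h : Γ.discriminant) :
    ∃ x : Γ.dualLattice, IsLeast {y | y ∈ Γ.lipmanCone ∧ (y : Γ.discriminant) = h} x := by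
  obtain ⟨x', rfl⟩ := QuotientAddGroup.mk_surjective h
  let P : ℤ → Prop := fun N => ∃ l : V → ℤ, (∀ i, Γ.form (x' + incl l) (base i) ≤ 0) ∧ ∑ i, l i = N
  have hbdd : ∃ b : ℤ, ∀ z, P z → b ≤ z := by
    refine ⟨⌊-∑ i, (x' : V → ℚ) i⌋, ?_⟩
    rintro z ⟨l, hl, rfl⟩
    have h0 := Γ.nonneg_of_antinef hl
    have : 0 ≤ ∑ i, ((x' : V → ℚ) i + (l i : ℚ)) := Finset.sum_nonneg fun i _ => h0 i
    rw [Finset.sum_add_distrib] at this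
    have h1 : -∑ i, (x' : V → ℚ) i ≤ ((∑ i, l i : ℤ) : ℚ) := by push_cast; linarith
    exact_mod_cast le_trans (Int.floor_le _) h1
  obtain ⟨l₁, hl₁⟩ := Γ.exists_antinef x'
  obtain ⟨N, ⟨l₀, hl₀, hN⟩, hmin⟩ := Int.exists_least_of_bdd hbdd ⟨_, l₁, hl₁, rfl⟩
  refine ⟨⟨x' + incl l₀, Γ.dualLattice.add_mem x'.2 (Γ.incl_mem l₀)⟩, ⟨hl₀, ?_⟩, ?_⟩
  · rw [eq_comm, QuotientAddGroup.eq, lattice, AddSubgroup.mem_addSubgroupOf]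
    exact ⟨l₀, by simp⟩
  · rintro y ⟨hy, hyh⟩
    rw [eq_comm, QuotientAddGroup.eq, lattice, AddSubgroup.mem_addSubgroupOf] at hyh
    obtain ⟨l, hl⟩ := hyh
    have hyl : (y : V → ℚ) = x' + incl l := by rw [hl]; simp
    have hinf : (x' : V → ℚ) + incl (l₀ ⊓ l) = (x' + incl l₀) ⊓ (x' + incl l) := by
      ext i
      simp [incl, min_add_add_left]
    have hP : P (∑ i, (l₀ ⊓ l) i) := by
      refine ⟨l₀ ⊓ l, fun i => ?_, rfl⟩
      rw [hinf]
      exact Γ.antinef_inf hl₀ (fun i => by rw [← hyl]; exact hy i) i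
    have hle := hmin _ hP
    rw [← hN] at hle
    have heq := (Finset.sum_eq_sum_iff_of_le (s := Finset.univ)
      (f := l₀ ⊓ l) (g := l₀) fun i _ => inf_le_left).mp
        (le_antisymm (Finset.sum_le_sum fun i _ => inf_le_left) hle)
    change (x' : V → ℚ) + incl l₀ ≤ y
    rw [hyl]
    intro i
    have hi : l₀ i ≤ l i := by
      have := heq i (Finset.mem_univ i)
      simpa using this
    simpa [incl] using hi

/-! ### The weight function -/

/-- `s_h`, the smallest element of the Lipman cone representing `h`. -/
def minRep (h : Γ.discriminant) : Γ.dualLattice := (Γ.exists_isLeast h).choose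

/-- The anticanonical cycle `Z_K`, determined by `(Z_K, E_i) = (E_i, E_i) + 2` for all `i`. -/
def anticanonical : V → ℚ := Γ.solve fun i => Γ.form (base i) (base i) + 2

lemma adjunction (i : V) :
    Γ.form Γ.anticanonical (base i) = Γ.form (base i) (base i) + 2 :=
  Γ.form_solve _ i

/-- The distinguished characteristic element `k_h = -Z_K + 2 s_h`. -/
def charElt (h : Γ.discriminant) : V → ℚ := -Γ.anticanonical + 2 • (Γ.minRep h : V → ℚ)

/-- The Riemann-Roch function `χ_h(l) = -(l, l + k_h)/2` on `L`. -/
def chi (h : Γ.discriminant) (l : V → ℤ) : ℚ := -(Γ.form (incl l) (incl l + Γ.charElt h)) / 2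

/-- `E_J = ∑_{j ∈ J} E_j`. -/
def sumBase (J : Finset V) : V → ℤ := fun i => if i ∈ J then 1 else 0

/-- The weight of the cube `(l, I)`: the maximum of `χ_h` on its vertices `l + E_J`, `J ⊆ I`. -/
def weight (h : Γ.discriminant) (l : V → ℤ) (I : Finset V) : ℚ :=
  I.powerset.sup' ⟨∅, Finset.empty_mem_powerset I⟩ fun J => Γ.chi h (l + sumBase J)

/-! ### The filtered cubical spaces -/

/-- The closed cube `(l, I)` in `ℝ^V`, with vertices `l + E_J`, `J ⊆ I`. -/
def cube (l : V → ℤ) (I : Finset V) : Set (V → ℝ) :=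
  {x | ∀ i, (l i : ℝ) ≤ x i ∧ x i ≤ l i + (if i ∈ I then 1 else 0)}

/-- The union of all cubes of `ℝ^V` of weight at most `n`. -/
def sublevel (h : Γ.discriminant) (n : ℤ) : Set (V → ℝ) :=
  {x | ∃ l I, Γ.weight h l I ≤ n ∧ x ∈ cube l I}

/-- The quadrant `𝔛 = (ℝ_{≥ 0})^V`. -/
def quadrant : Set (V → ℝ) := {x | ∀ i, 0 ≤ x i}

/-- `𝔛_p`, the union of the cubes `(l, I)` with `l ≥ 0` and `(s, l) ≤ p`. -/
def filt (s : Γ.dualLattice) (p : ℤ) : Set (V → ℝ) :=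
  {x | ∃ l I, 0 ≤ l ∧ Γ.form s (incl l) ≤ p ∧ x ∈ cube l I}

/-- `S_n ∩ 𝔛`. -/
def space (h : Γ.discriminant) (n : ℤ) : Set (V → ℝ) := Γ.sublevel h n ∩ quadrant

/-- `S_n ∩ 𝔛_p`. -/
def piece (h : Γ.discriminant) (s : Γ.dualLattice) (n p : ℤ) : Set (V → ℝ) :=
  Γ.sublevel h n ∩ Γ.filt s p

lemma piece_subset_space (h : Γ.discriminant) (s : Γ.dualLattice) (n p : ℤ) :
    Γ.piece h s n p ⊆ Γ.space h n := by
  rintro x ⟨hx, l, I, hl, -, hc⟩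
  exact ⟨hx, fun i => le_trans (by exact_mod_cast hl i) (hc i).1⟩

lemma sublevel_mono (h : Γ.discriminant) {n n' : ℤ} (hn : n ≤ n') :
    Γ.sublevel h n ⊆ Γ.sublevel h n' := by
  rintro x ⟨l, I, hw, hc⟩
  exact ⟨l, I, hw.trans (by exact_mod_cast hn), hc⟩

lemma space_mono (h : Γ.discriminant) {n n' : ℤ} (hn : n ≤ n') :
    Γ.space h n ⊆ Γ.space h n' :=
  Set.inter_subset_inter_left _ (Γ.sublevel_mono h hn)

lemma piece_mono (h : Γ.discriminant) (s : Γ.dualLattice) {n n' p p' : ℤ} (hn : n ≤ n')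
    (hp : p ≤ p') : Γ.piece h s n p ⊆ Γ.piece h s n' p' := by
  rintro x ⟨hx, l, I, hl, hs, hc⟩
  exact ⟨Γ.sublevel_mono h hn hx, l, I, hl, hs.trans (by exact_mod_cast hp), hc⟩

end ResolutionGraph

/-! ### Singular chains and relative homology of subspaces -/

section Singular

variable {X : Type} [TopologicalSpace X]

/-- The singular chain complex, with integral coefficients, of a subspace `A` of `X`. -/
def chains (A : Set X) : ChainComplex AddCommGrpCat.{0} ℕ :=
  ((singularChainComplexFunctor AddCommGrpCat.{0}).obj (AddCommGrpCat.of ℤ)).obj (TopCat.of A)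

/-- The chain map induced by an inclusion of subspaces. -/
def chainsIncl {A B : Set X} (h : A ⊆ B) : chains A ⟶ chains B :=
  ((singularChainComplexFunctor AddCommGrpCat.{0}).obj (AddCommGrpCat.of ℤ)).map
    (TopCat.ofHom ⟨Set.inclusion h, continuous_inclusion h⟩)

lemma chainsIncl_comp {A B C : Set X} (h : A ⊆ B) (h' : B ⊆ C) :
    chainsIncl h ≫ chainsIncl h' = chainsIncl (h.trans h') := by
  exact (((singularChainComplexFunctor AddCommGrpCat.{0}).obj (AddCommGrpCat.of ℤ)).map_comp
    (TopCat.ofHom ⟨Set.inclusion h, continuous_inclusion h⟩)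
    (TopCat.ofHom ⟨Set.inclusion h', continuous_inclusion h'⟩)).symm

/-- The map induced on singular `m`-chains by an inclusion of subspaces. -/
def inclOn {A B : Set X} (h : A ⊆ B) (m : ℕ) : (chains A).X m →+ (chains B).X m :=
  ((chainsIncl h).f m).hom

lemma inclOn_inclOn {A B C : Set X} (h : A ⊆ B) (h' : B ⊆ C) (m : ℕ) (x : (chains A).X m) :
    inclOn h' m (inclOn h m x) = inclOn (h.trans h') m x := by
  rw [inclOn, inclOn, inclOn, ← chainsIncl_comp h h']
  rfl

lemma inclOn_d {A B : Set X} (h : A ⊆ B) (i j : ℕ) (x : (chains A).X i) :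
    inclOn h j (((chains A).d i j).hom x) = ((chains B).d i j).hom (inclOn h i x) :=
  (ConcreteCategory.congr_hom ((chainsIncl h).comm i j) x).symm

/-- The singular homology `H_m(B, A; ℤ)` of a pair `A ⊆ B`. -/
def relHomology {A B : Set X} (h : A ⊆ B) (m : ℕ) : AddCommGrpCat.{0} :=
  (Limits.cokernel (chainsIncl h)).homology m

/-- The map `H_m(B, A; ℤ) → H_m(B', A'; ℤ)` induced by an inclusion of pairs. -/
def relHomologyMap {A B A' B' : Set X} (h : A ⊆ B) (h' : A' ⊆ B') (hA : A ⊆ A') (hB : B ⊆ B')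
    (m : ℕ) : relHomology h m ⟶ relHomology h' m :=
  HomologicalComplex.homologyMap
    (Limits.cokernel.map (chainsIncl h) (chainsIncl h') (chainsIncl hA) (chainsIncl hB)
      (by rw [chainsIncl_comp, chainsIncl_comp])) m

end Singular

/-! ### The spectral sequence of a filtered complex -/

/-- A chain complex of abelian groups with an increasing filtration by subcomplexes. -/
structure FilteredComplex where
  C : ChainComplex AddCommGrpCat.{0} ℕ
  F : ℤ → (m : ℕ) → AddSubgroup (C.X m)
  mono : ∀ m, Monotone fun p => F p m
  d_mem : ∀ (p : ℤ) (i j : ℕ) (x : C.X i), x ∈ F p i → (C.d i j).hom x ∈ F p j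

/-- A filtered chain map. -/
structure FilteredComplex.Hom (K K' : FilteredComplex) where
  f : K.C ⟶ K'.C
  map_mem : ∀ (p : ℤ) (m : ℕ) (x : K.C.X m), x ∈ K.F p m → (f.f m).hom x ∈ K'.F p m

namespace FilteredComplex

variable (K : FilteredComplex)

/-- `F_p C_m` for an integral degree `m`; it is zero for `m < 0`. -/
def fil (p m : ℤ) : AddSubgroup (K.C.X m.toNat) := if 0 ≤ m then K.F p m.toNat else ⊥

/-- `Z^k_p = {x ∈ F_p C_m : ∂ x ∈ F_{p-k} C_{m-1}}`, in total degree `m`. -/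
def cyc (k p m : ℤ) : AddSubgroup (K.C.X m.toNat) :=
  K.fil p m ⊓ (K.fil (p - k) (m - 1)).comap (K.C.d m.toNat (m - 1).toNat).hom

/-- `Z^{k-1}_{p-1} + ∂ Z^{k-1}_{p+k-1}`, in total degree `m`. -/
def bdry (k p m : ℤ) : AddSubgroup (K.C.X m.toNat) :=
  K.cyc (k - 1) (p - 1) m ⊔
    (K.cyc (k - 1) (p + k - 1) (m + 1)).map (K.C.d (m + 1).toNat m.toNat).hom

/-- The module `E^k_{p,q} = Z^k_p / (Z^{k-1}_{p-1} + ∂ Z^{k-1}_{p+k-1})`, `k ≥ 1`, in total degree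
`p + q`, of the homological spectral sequence of the filtered complex. -/
def page (k p q : ℤ) : Type :=
  K.cyc k p (p + q) ⧸ (K.bdry k p (p + q)).addSubgroupOf (K.cyc k p (p + q))

instance (k p q : ℤ) : AddCommGroup (K.page k p q) :=
  inferInstanceAs (AddCommGroup
    (K.cyc k p (p + q) ⧸ (K.bdry k p (p + q)).addSubgroupOf (K.cyc k p (p + q))))

variable {K} {K' : FilteredComplex} (φ : K.Hom K')

lemma Hom.map_d (i j : ℕ) (x : K.C.X i) :
    (φ.f.f j).hom ((K.C.d i j).hom x) = (K'.C.d i j).hom ((φ.f.f i).hom x) :=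
  (ConcreteCategory.congr_hom (φ.f.comm i j) x).symm

lemma Hom.map_fil {p m : ℤ} {x : K.C.X m.toNat} (hx : x ∈ K.fil p m) :
    (φ.f.f m.toNat).hom x ∈ K'.fil p m := by
  unfold fil at hx ⊢
  split_ifs with h
  · rw [if_pos h] at hx
    exact φ.map_mem _ _ _ hx
  · rw [if_neg h, AddSubgroup.mem_bot] at hx
    simp [hx]

lemma Hom.map_cyc {k p m : ℤ} {x : K.C.X m.toNat} (hx : x ∈ K.cyc k p m) :
    (φ.f.f m.toNat).hom x ∈ K'.cyc k p m := by
  refine ⟨φ.map_fil hx.1, ?_⟩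
  change (K'.C.d _ _).hom _ ∈ K'.fil _ _
  rw [← φ.map_d]
  exact φ.map_fil hx.2

lemma Hom.map_bdry {k p m : ℤ} {x : K.C.X m.toNat} (hx : x ∈ K.bdry k p m) :
    (φ.f.f m.toNat).hom x ∈ K'.bdry k p m := by
  obtain ⟨y, hy, z, ⟨w, hw, rfl⟩, rfl⟩ := AddSubgroup.mem_sup.mp hx
  rw [map_add, φ.map_d]
  exact AddSubgroup.mem_sup.mpr ⟨_, φ.map_cyc hy, _, ⟨_, φ.map_cyc hw, rfl⟩, rfl⟩

/-- The map of pages induced by a filtered chain map. -/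
def Hom.pageMap (k p q : ℤ) : K.page k p q →+ K'.page k p q :=
  QuotientAddGroup.map ((K.bdry k p (p + q)).addSubgroupOf (K.cyc k p (p + q)))
    ((K'.bdry k p (p + q)).addSubgroupOf (K'.cyc k p (p + q)))
    (((φ.f.f (p + q).toNat).hom.comp (K.cyc k p (p + q)).subtype).codRestrict
      (K'.cyc k p (p + q)) fun x => φ.map_cyc x.2)
    fun _ hx => φ.map_bdry hx

end FilteredComplex

/-! ### The pages `(E^k_{-d,q})_n` and the action of `U` -/

namespace ResolutionGraph

variable (Γ : ResolutionGraph V) (h : Γ.discriminant) (s : Γ.dualLattice)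

/-- The singular chains of `S_n ∩ 𝔛`, filtered by the images of the chains of the subspaces
`S_n ∩ 𝔛_p`. -/
def filteredChains (n : ℤ) : FilteredComplex where
  C := chains (Γ.space h n)
  F p m := (inclOn (Γ.piece_subset_space h s n p) m).range
  mono m := by
    rintro p p' hp _ ⟨y, rfl⟩
    exact ⟨inclOn (Γ.piece_mono h s le_rfl hp) m y, inclOn_inclOn _ _ _ _⟩
  d_mem := by
    rintro p i j _ ⟨y, rfl⟩
    exact ⟨((chains _).d i j).hom y, inclOn_d _ _ _ _⟩

/-- The filtered chain map induced by the inclusion of `S_n` into `S_{n+1}`. -/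
def filteredIncl (n : ℤ) : (Γ.filteredChains h s n).Hom (Γ.filteredChains h s (n + 1)) where
  f := chainsIncl (Γ.space_mono h (Int.le_add_one le_rfl))
  map_mem := by
    rintro p m _ ⟨y, rfl⟩
    exact ⟨inclOn (Γ.piece_mono h s (Int.le_add_one le_rfl) le_rfl) m y,
      (inclOn_inclOn _ _ m y).trans (inclOn_inclOn _ _ m y).symm⟩

/-- The module `(E^k_{-d,q})_n` with index `i = (n, d, q)`, in the spectral sequence of the
filtration `{S_n ∩ 𝔛_{-d}}_d` of `S_n ∩ 𝔛`. -/
def E (k : ℤ) (i : ℤ × ℕ × ℤ) : Type := (Γ.filteredChains h s i.1).page k (-(i.2.1 : ℤ)) i.2.2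

instance (k : ℤ) (i : ℤ × ℕ × ℤ) : AddCommGroup (Γ.E h s k i) :=
  inferInstanceAs (AddCommGroup ((Γ.filteredChains h s i.1).page k (-(i.2.1 : ℤ)) i.2.2))

/-- The map `(E^k_{-d,q})_n → (E^k_{-d,q})_{n+1}` induced by the inclusion of `S_n` into
`S_{n+1}`. -/
def stepU (k : ℤ) (i : ℤ × ℕ × ℤ) : Γ.E h s k i →+ Γ.E h s k (i.1 + 1, i.2) :=
  (Γ.filteredIncl h s i.1).pageMap k (-(i.2.1 : ℤ)) i.2.2

/-- The triple graded module `(E^k_{*,*})_*`. -/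
abbrev totalPage (k : ℤ) : Type := DirectSum (ℤ × ℕ × ℤ) (Γ.E h s k)

/-- The inclusion of a homogeneous summand `(E^k_{-d,q})_n` into `(E^k_{*,*})_*`. -/
def summand (k : ℤ) (i : ℤ × ℕ × ℤ) : Γ.E h s k i →+ Γ.totalPage h s k :=
  DirectSum.of (Γ.E h s k) i

/-- The operator `U` on `(E^k_{*,*})_*`, of degree `(1, 0, 0)` with respect to `(n, d, q)`. -/
def U (k : ℤ) : Module.End ℤ (Γ.totalPage h s k) :=
  (DirectSum.toAddMonoid fun i : ℤ × ℕ × ℤ =>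
    (Γ.summand h s k (i.1 + 1, i.2)).comp (Γ.stepU h s k i)).toIntLinearMap

/-- The map `H_m(S_n ∩ 𝔛_{-d}, S_n ∩ 𝔛_{-d-1}; ℤ) → H_m(S_{n+δ} ∩ 𝔛_{-d}, S_{n+δ} ∩ 𝔛_{-d-1}; ℤ)`
induced by the inclusion of `S_n` into `S_{n+δ}`. -/
def relMap (n : ℤ) (δ d m : ℕ) :
    relHomology (Γ.piece_mono h s (n := n) (p := -(d : ℤ) - 1) (p' := -(d : ℤ)) le_rfl (by lia)) m ⟶
      relHomology (Γ.piece_mono h s (n := n + δ) (p := -(d : ℤ) - 1) (p' := -(d : ℤ)) le_rfl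
        (by lia)) m :=
  relHomologyMap _ _ (Γ.piece_mono h s (by lia) le_rfl) (Γ.piece_mono h s (by lia) le_rfl) m

end ResolutionGraph

end FilteredLattice

end

/-! Since `s` is a nonzero element of the Lipman cone, some $E_i$ has $(s,E_i)\le -1$
(`exists_form_base_le_neg_one`). Slide everything along $x\mapsto x+tE_i$, $0\le t\le1$. Negative
definiteness bounds $(l,l)$ on $\{\chi_h\le n\}$, so the slide of $S_n$ stays in $S_{n+\delta}$ for
a $\delta$ depending only on $n$ and $i$ (`exists_sublevel_translate`). It preserves every
$\mathfrak X_p$, and its end, the translation by $E_i$, maps $\mathfrak X_p$ into $\mathfrak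
X_{p-1}$. Thus $U^\delta$ is homotopic, through filtered maps, to a map that lowers the filtration
by one.

On relative homology such a map is zero (`homologyMap_cokernelMap_eq_zero`). On pages, if $P$ is the
chain homotopy and $\psi$ the translation, then $\varphi x=\partial Px+(P\partial x+\psi x)$ writes
the image of a cycle as an element of the denominator of $E^k$ (`Hom.map_mem_bdry`). Both arguments
need $P$ to respect subspaces, hence the naturality of the prism operator. -/

namespace FilteredLattice

/-! ### Naturality of the singular chain homotopy in the topological homotopy -/

section Naturality

open Limits MonoidalCategory Simplicial

universe u

/-- The simplicial prism operators are natural in the homotopy. -/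
lemma simplicialHomotopy_natural {X Y X' Y' : SSet.{u}} {f g : X ⟶ Y} {f' g' : X' ⟶ Y'}
    (H : SSet.Homotopy f g) (H' : SSet.Homotopy f' g') (p : X ⟶ X') (q : Y ⟶ Y')
    (hpq : H.h ≫ q = p ▷ Δ[1] ≫ H'.h) {n : ℕ} (i : Fin (n + 1)) :
    H.toSimplicialObjectHomotopy.h i ≫ q.app _ =
      p.app _ ≫ H'.toSimplicialObjectHomotopy.h i := by
  ext x
  -- The `i`-th prism operator on `x` is the value of the homotopy on the `i`-th nondegenerate top
  -- simplex of $\Delta[n]\times\Delta[1]$, so `hpq` need only be evaluated there.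
  have e := ConcreteCategory.congr_hom (congr_arg (fun φ : X ⊗ Δ[1] ⟶ Y' =>
    (SSet.yonedaEquiv.symm x ▷ Δ[1] ≫ φ).app (.op ⦋n + 1⦌)) hpq)
      (SSet.prodStdSimplex.nonDegenerateEquiv₁ i).1
  have e' : SSet.yonedaEquiv.symm (p.app _ x) = SSet.yonedaEquiv.symm x ≫ p := by
    rw [SSet.yonedaEquiv_symm_comp]
  simp only [SSet.Homotopy.toSimplicialObjectHomotopy]
  change _ = ((SSet.yonedaEquiv.symm (p.app _ x)) ▷ Δ[1] ≫ H'.h).app _ _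
  rw [e', comp_whiskerRight, Category.assoc, ← e]
  rfl

lemma toSSet_natural {X Y X' Y' : TopCat.{u}} {f g : X ⟶ Y} {f' g' : X' ⟶ Y'}
    (H : TopCat.Homotopy f g) (H' : TopCat.Homotopy f' g') (p : X ⟶ X') (q : Y ⟶ Y')
    (hpq : ∀ t x, q (H (t, x)) = H' (t, p x)) :
    H.toSSet.h ≫ TopCat.toSSet.map q = TopCat.toSSet.map p ▷ Δ[1] ≫ H'.toSSet.h := by
  have e : H.h ≫ q = p ▷ TopCat.I ≫ H'.h := by
    ext x
    exact hpq _ _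
  simp only [TopCat.Homotopy.toSSet, Category.assoc, ← Functor.map_comp, e]
  rw [← whisker_exchange_assoc]
  simp

/-- The chain homotopy attached to a simplicial homotopy is natural. -/
lemma chainHomotopy_natural {𝒞 : Type*} [Category* 𝒞] [Preadditive 𝒞]
    {X Y X' Y' : SimplicialObject 𝒞} {f g : X ⟶ Y} {f' g' : X' ⟶ Y'}
    (H : SimplicialObject.Homotopy f g) (H' : SimplicialObject.Homotopy f' g')
    (p : X ⟶ X') (q : Y ⟶ Y')
    (hpq : ∀ {n : ℕ} (i : Fin (n + 1)), H.h i ≫ q.app _ = p.app _ ≫ H'.h i) (i j : ℕ) :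
    H.toChainHomotopy.hom i j ≫ q.app (.op ⦋j⦌) = p.app (.op ⦋i⦌) ≫ H'.toChainHomotopy.hom i j := by
  change SimplicialObject.Homotopy.ToChainHomotopy.hom H i j ≫ _ =
    _ ≫ SimplicialObject.Homotopy.ToChainHomotopy.hom H' i j
  by_cases hij : i + 1 = j
  · subst hij
    simp [Preadditive.sum_comp, Preadditive.comp_sum, hpq]
  · simp [hij]

/-- The chain homotopy between the maps of singular chains is natural in the homotopy. -/
lemma singularHomotopy_natural {X Y X' Y' : TopCat.{0}} {f g : X ⟶ Y} {f' g' : X' ⟶ Y'}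
    (H : TopCat.Homotopy f g) (H' : TopCat.Homotopy f' g') (p : X ⟶ X') (q : Y ⟶ Y')
    (hpq : ∀ t x, q (H (t, x)) = H' (t, p x)) (R : AddCommGrpCat.{0}) (i j : ℕ) :
    (H.singularChainComplexFunctorObjMap R).hom i j ≫
        (((singularChainComplexFunctor AddCommGrpCat.{0}).obj R).map q).f j =
      (((singularChainComplexFunctor AddCommGrpCat.{0}).obj R).map p).f i ≫
        (H'.singularChainComplexFunctorObjMap R).hom i j := by
  refine chainHomotopy_natural _ _ (((SimplicialObject.whiskering _ _).obj
    (sigmaConst.obj R)).map (TopCat.toSSet.map p)) (((SimplicialObject.whiskering _ _).obj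
    (sigmaConst.obj R)).map (TopCat.toSSet.map q)) (fun k => ?_) i j
  exact ((sigmaConst.obj R).map_comp _ _).symm.trans ((congr_arg (sigmaConst.obj R).map
    (simplicialHomotopy_natural H.toSSet H'.toSSet (TopCat.toSSet.map p)
      (TopCat.toSSet.map q) (toSSet_natural H H' p q hpq) k)).trans
      ((sigmaConst.obj R).map_comp _ _))

end Naturality

/-! ### Vanishing on relative homology -/

section Cokernel

open Limits

universe v u w

variable {𝒜 : Type u} [Category.{v} 𝒜] [Abelian 𝒜] {ι : Type w} {c : ComplexShape ι}

/-- If a map of pairs is homotopic, through a homotopy of pairs, to one that sends the whole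
complex into the subcomplex, it vanishes on relative homology. -/
lemma homologyMap_cokernelMap_eq_zero {A B A' B' : HomologicalComplex 𝒜 c}
    (a : A ⟶ B) (a' : A' ⟶ B') (ψ : A ⟶ A') (φ : B ⟶ B') (g : B ⟶ A')
    (hw : a ≫ φ = ψ ≫ a') (H : Homotopy φ (g ≫ a')) (k : ∀ i j, A.X i ⟶ A'.X j)
    (hk : ∀ i j, a.f i ≫ H.hom i j = k i j ≫ a'.f j) (m : ι) :
    HomologicalComplex.homologyMap (cokernel.map a a' ψ φ hw) m = 0 := by
  -- By `hk` the homotopy carries `A` into `A'`, so each component descends to the quotients;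
  -- cokernels of complexes are computed degreewise.
  have key (i j : ι) : ∃ r : (cokernel a).X i ⟶ (cokernel a').X j,
      (cokernel.π a).f i ≫ r = H.hom i j ≫ (cokernel.π a').f j := by
    have hc := CokernelCofork.mapIsColimit _ (cokernelIsCokernel a)
      (HomologicalComplex.eval 𝒜 c i)
    have z : a.f i ≫ H.hom i j ≫ (cokernel.π a').f j = 0 := by
      rw [← Category.assoc, hk, Category.assoc, ← HomologicalComplex.comp_f, cokernel.condition,
        HomologicalComplex.zero_f, comp_zero]
    exact ⟨hc.desc (CokernelCofork.ofπ _ z), hc.fac _ WalkingParallelPair.one⟩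
  choose r hr using key
  have hr' (i j : ι) {Z : 𝒜} (f : (cokernel a').X j ⟶ Z) :
      (cokernel.π a).f i ≫ r i j ≫ f = H.hom i j ≫ (cokernel.π a').f j ≫ f := by
    rw [← Category.assoc, hr, Category.assoc]
  have hepi (i : ι) : Epi ((cokernel.π a).f i) := inferInstance
  let K : Homotopy (cokernel.map a a' ψ φ hw) 0 :=
    { hom := r
      zero i j hij := by
        rw [← cancel_epi ((cokernel.π a).f i), hr, H.zero i j hij]
        simp
      comm i := by
        rw [← cancel_epi ((cokernel.π a).f i)]
        have e := H.comm i
        have e1 : (cokernel.π a).f i ≫ (cokernel.map a a' ψ φ hw).f i =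
            φ.f i ≫ (cokernel.π a').f i := by
          rw [← HomologicalComplex.comp_f, ← HomologicalComplex.comp_f]
          simp
        -- The end of the homotopy factors through `a'`, so it dies in the quotient: the descended
        -- homotopy ends at zero.
        have e2 : a'.f i ≫ (cokernel.π a').f i = 0 := by
          rw [← HomologicalComplex.comp_f, cokernel.condition, HomologicalComplex.zero_f]
        rw [e1, e]
        simp only [Preadditive.add_comp, Preadditive.comp_add, HomologicalComplex.comp_f,
          Category.assoc, e2, HomologicalComplex.zero_f, comp_zero, add_zero, dNext, prevD,
          AddMonoidHom.mk'_apply, hr, hr', HomologicalComplex.Hom.comm,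
          HomologicalComplex.Hom.comm_assoc, HomologicalComplex.zero_f] }
  rw [K.homologyMap_eq, HomologicalComplex.homologyMap_zero]

end Cokernel

/-! ### Vanishing on all pages of the spectral sequence -/

namespace FilteredComplex

variable {K K' : FilteredComplex}

lemma fil_mono (K : FilteredComplex) {p p' : ℤ} (hp : p ≤ p') (m : ℤ) :
    K.fil p m ≤ K.fil p' m := by
  unfold fil
  split_ifs
  · exact K.mono _ hp
  · exact le_rfl

/-- The degrees `b` and `c` are free so that the lemma applies to degrees written with `toNat`. For
`a = 0` truncation gives `c = 0`, and the extra term vanishes because `C.d 0 0 = 0`. -/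
lemma homotopy_apply {C C' : ChainComplex AddCommGrpCat.{0} ℕ} {f g : C ⟶ C'}
    (H : Homotopy f g) {a b c : ℕ} (hb : b = a + 1) (hc : c = a - 1) (x : C.X a) :
    (f.f a).hom x = (C'.d b a).hom ((H.hom a b).hom x) + (H.hom c a).hom ((C.d a c).hom x) +
      (g.f a).hom x := by
  subst hb hc
  have e := ConcreteCategory.congr_hom (H.comm a) x
  rw [Homotopy.prevD_chainComplex] at e
  cases a with
  | zero =>
    rw [Homotopy.dNext_zero_chainComplex, zero_add] at e
    have : C.d 0 (0 - 1) = 0 := C.shape _ _ (by simp)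
    rw [this]
    simpa using e
  | succ a =>
    rw [Homotopy.dNext_succ_chainComplex, add_comm ((C.d _ _) ≫ _)] at e
    exact e

/-- A filtered chain homotopy from a filtered map to one that lowers the filtration degree kills
all pages. -/
lemma Hom.map_mem_bdry (φ : K.Hom K') (ψ : K.C ⟶ K'.C) (H : Homotopy φ.f ψ)
    (hψ : ∀ (p : ℤ) (m : ℕ) (x : K.C.X m), x ∈ K.F p m → (ψ.f m).hom x ∈ K'.F (p - 1) m)
    (hH : ∀ (p : ℤ) (m m' : ℕ) (x : K.C.X m), x ∈ K.F p m → (H.hom m m').hom x ∈ K'.F p m')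
    {k : ℤ} (hk : 1 ≤ k) (p m : ℤ) {x : K.C.X m.toNat} (hx : x ∈ K.cyc k p m) :
    (φ.f.f m.toNat).hom x ∈ K'.bdry k p m := by
  obtain ⟨hx1, hx2⟩ := hx
  change x ∈ K.fil p m at hx1
  change (K.C.d m.toNat (m - 1).toNat).hom x ∈ K.fil (p - k) (m - 1) at hx2
  rcases lt_or_ge m 0 with hm | hm
  · rw [fil, if_neg hm.not_ge, AddSubgroup.mem_bot] at hx1
    rw [hx1, map_zero]
    exact zero_mem _
  have hψ' {p m : ℤ} {x : K.C.X m.toNat} (hx : x ∈ K.fil p m) :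
      (ψ.f m.toNat).hom x ∈ K'.fil (p - 1) m := by
    unfold fil at hx ⊢
    split_ifs with h
    · rw [if_pos h] at hx
      exact hψ _ _ _ hx
    · rw [if_neg h, AddSubgroup.mem_bot] at hx
      simp [hx]
  have hH' {p m m' : ℤ} (hm' : 0 ≤ m') {x : K.C.X m.toNat} (hx : x ∈ K.fil p m) :
      (H.hom m.toNat m'.toNat).hom x ∈ K'.fil p m' := by
    unfold fil at hx ⊢
    rw [if_pos hm']
    split_ifs at hx with h
    · exact hH _ _ _ _ hx
    · rw [AddSubgroup.mem_bot] at hx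
      simp [hx]
  have hφx := φ.map_fil hx1
  have hψx := hψ' hx1
  have hdx := φ.map_fil hx2
  have hP := hH' (m' := m + 1) (by omega) hx1
  have hPd := hH' (m' := m) hm hx2
  have e := homotopy_apply H (a := m.toNat) (b := (m + 1).toNat) (c := (m - 1).toNat)
    (by omega) (by omega) x
  have hz : (K'.C.d (m + 1).toNat m.toNat).hom ((H.hom m.toNat (m + 1).toNat).hom x) =
      (φ.f.f m.toNat).hom x - (H.hom (m - 1).toNat m.toNat).hom
        ((K.C.d m.toNat (m - 1).toNat).hom x) - (ψ.f m.toNat).hom x := by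
    rw [e]; abel
  have hdd : (K'.C.d m.toNat (m - 1).toNat).hom
      ((K'.C.d (m + 1).toNat m.toNat).hom ((H.hom m.toNat (m + 1).toNat).hom x)) = 0 :=
    ConcreteCategory.congr_hom (K'.C.d_comp_d (m + 1).toNat m.toNat (m - 1).toNat) _
  -- This element is $\varphi x-\partial Px$, so its boundary is $\varphi\partial x\in
  -- F_{p-k}=F_{(p-1)-(k-1)}$. It lies in $F_{p-1}$ itself because $P\partial x\in F_{p-k}$ with
  -- $k\ge1$, and $\psi$ lowers the filtration.
  have hy : (H.hom (m - 1).toNat m.toNat).hom ((K.C.d m.toNat (m - 1).toNat).hom x) +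
      (ψ.f m.toNat).hom x ∈ K'.cyc (k - 1) (p - 1) m := by
    refine ⟨add_mem (K'.fil_mono (by omega) _ hPd) hψx, ?_⟩
    change (K'.C.d m.toNat (m - 1).toNat).hom _ ∈ K'.fil (p - 1 - (k - 1)) (m - 1)
    have e' : (H.hom (m - 1).toNat m.toNat).hom ((K.C.d m.toNat (m - 1).toNat).hom x) +
        (ψ.f m.toNat).hom x = (φ.f.f m.toNat).hom x -
          (K'.C.d (m + 1).toNat m.toNat).hom ((H.hom m.toNat (m + 1).toNat).hom x) := by
      rw [e]; abel
    rw [e', map_sub, hdd, sub_zero, ← φ.map_d]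
    exact K'.fil_mono (by omega) _ hdx
  -- Here $k\ge1$ gives $F_p\subset F_{p+k-1}$, and the boundary condition for $Z^{k-1}_{p+k-1}$
  -- asks only that $\partial Px\in F_p$.
  have hw : (H.hom m.toNat (m + 1).toNat).hom x ∈ K'.cyc (k - 1) (p + k - 1) (m + 1) := by
    refine ⟨K'.fil_mono (by omega) _ hP, ?_⟩
    have hmem : (K'.C.d (m + 1).toNat m.toNat).hom ((H.hom m.toNat (m + 1).toNat).hom x) ∈
        K'.fil (p + k - 1 - (k - 1)) m := by
      rw [hz]
      exact sub_mem (sub_mem (K'.fil_mono (by omega) _ hφx) (K'.fil_mono (by omega) _ hPd))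
        (K'.fil_mono (by omega) _ hψx)
    -- The degree `m + 1 - 1` equals `m` only propositionally, and the chain groups depend on it;
    -- hence the generalisation to `m'`.
    have : ∀ m' : ℤ, m' = m → (K'.C.d (m + 1).toNat m'.toNat).hom
        ((H.hom m.toNat (m + 1).toNat).hom x) ∈ K'.fil (p + k - 1 - (k - 1)) m' := by
      rintro _ rfl
      exact hmem
    exact this _ (by omega)
  refine AddSubgroup.mem_sup.mpr ⟨_, hy, _, ⟨_, hw, rfl⟩, ?_⟩
  rw [e]
  abel

end FilteredComplex

/-! ### Translation by a base element: weights, cubes and the filtration -/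

namespace ResolutionGraph

variable {V : Type} [Fintype V] [DecidableEq V] (Γ : ResolutionGraph V)

lemma form_comm (x y : V → ℚ) : Γ.form x y = Γ.form y x := by
  rw [form_apply, form_apply, Finset.sum_comm]
  refine Finset.sum_congr rfl fun i _ => Finset.sum_congr rfl fun j _ => ?_
  rw [Γ.matrix_symm j i]
  ring

lemma form_self_nonpos (x : V → ℚ) : Γ.form x x ≤ 0 := by
  rcases eq_or_ne x 0 with rfl | hx
  · simp
  · exact (Γ.negDef x hx).le

/-- The arithmetic-geometric mean inequality for the intersection form. -/
lemma abs_form_le (x y : V → ℚ) : |Γ.form x y| ≤ -(Γ.form x x + Γ.form y y) / 2 := by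
  have h1 := Γ.form_self_nonpos (x + y)
  have h2 := Γ.form_self_nonpos (x - y)
  simp only [map_add, map_sub, LinearMap.add_apply, LinearMap.sub_apply, Γ.form_comm y x] at h1 h2
  rw [abs_le]
  constructor <;> linarith

/-- On a sublevel set, the weight function grows by a bounded amount under translation by a
fixed lattice vector. -/
lemma exists_chi_add_le (h : Γ.discriminant) (n : ℤ) (v : V → ℤ) :
    ∃ N : ℚ, ∀ l, Γ.chi h l ≤ n → Γ.chi h (l + v) ≤ N := by
  -- From $\chi_h(l)\le n$ and the mean inequality for $(l,k_h)$ one gets $-(l,l)\le 4n-(k_h,k_h)$.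
  -- The same inequality for $(l,v)$ then bounds the last term of
  -- $\chi_h(l+v)=\chi_h(l)+\chi_h(v)-(l,v)$.
  refine ⟨n + Γ.chi h v + -(-(4 * n - Γ.form (Γ.charElt h) (Γ.charElt h)) +
    Γ.form (incl v) (incl v)) / 2, fun l hl => ?_⟩
  have h1 := (abs_le.mp (Γ.abs_form_le (incl l) (incl v))).1
  have h2 := (abs_le.mp (Γ.abs_form_le (incl l) (Γ.charElt h))).2
  have e : Γ.chi h (l + v) = Γ.chi h l + Γ.chi h v - Γ.form (incl l) (incl v) := by
    simp only [chi, map_add, LinearMap.add_apply, Γ.form_comm (incl v) (incl l)]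
    ring
  rw [e]
  simp only [chi, map_add] at hl ⊢
  linarith

lemma chi_le_weight (h : Γ.discriminant) (l : V → ℤ) (I : Finset V) :
    Γ.chi h l ≤ Γ.weight h l I := by
  have := Finset.le_sup' (fun J => Γ.chi h (l + sumBase J)) (Finset.empty_mem_powerset I)
  have e : sumBase (∅ : Finset V) = 0 := by
    ext
    simp [sumBase]
  rw [e, add_zero] at this
  exact this

lemma exists_weight_add_le (h : Γ.discriminant) (n : ℤ) (v : V → ℤ) :
    ∃ N : ℤ, ∀ l, Γ.chi h l ≤ n → Γ.weight h (l + v) Finset.univ ≤ N := by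
  choose f hf using fun J : Finset V => Γ.exists_chi_add_le h n (v + sumBase J)
  obtain ⟨N, hN⟩ := exists_nat_ge (∑ J, |f J|)
  refine ⟨N, fun l hl => Finset.sup'_le _ _ fun J _ => ?_⟩
  rw [add_assoc, Int.cast_natCast]
  exact (hf J l hl).trans ((le_abs_self _).trans ((Finset.single_le_sum
    (f := fun J => |f J|) (fun _ _ => abs_nonneg _) (Finset.mem_univ J)).trans hN))

lemma cube_subset_univ (l : V → ℤ) (I : Finset V) : cube l I ⊆ cube l Finset.univ := by
  intro x hx i
  have := hx i
  simp only [Finset.mem_univ, if_true]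
  refine ⟨this.1, this.2.trans ?_⟩
  split_ifs <;> simp

/-- Translating a point of a cube by at most one unit in the direction of `i`. -/
lemma add_smul_mem_cube {l : V → ℤ} {I : Finset V} {x : V → ℝ} (hx : x ∈ cube l I) (i : V)
    {t : ℝ} (h0 : 0 ≤ t) (h1 : t ≤ 1) :
    x + t • Pi.single i 1 ∈ cube l Finset.univ ∨
      x + t • Pi.single i 1 ∈ cube (l + Pi.single i 1) Finset.univ := by
  -- In the full cube only the upper bound on the `i`-th coordinate can fail after the move.
  have hx := cube_subset_univ l I hx
  rcases le_total (x i + t) (l i + 1) with hi | hi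
  · left
    intro j
    have := hx j
    simp only [Finset.mem_univ, if_true] at this ⊢
    rcases eq_or_ne j i with rfl | hj
    · simp
      constructor <;> linarith
    · simpa [hj] using this
  · right
    intro j
    have := hx j
    simp only [Finset.mem_univ, if_true] at this ⊢
    rcases eq_or_ne j i with rfl | hj
    · simp
      constructor <;> linarith
    · simpa [hj] using this

omit [Fintype V] in
lemma add_single_mem_cube {l : V → ℤ} {I : Finset V} {x : V → ℝ} (hx : x ∈ cube l I) (i : V) :
    x + Pi.single i 1 ∈ cube (l + Pi.single i 1) I := by
  intro j
  have := hx j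
  rcases eq_or_ne j i with rfl | hj
  · simp
    constructor <;> linarith
  · simpa [hj] using this

lemma exists_sublevel_translate (h : Γ.discriminant) (n : ℤ) (i : V) :
    ∃ δ : ℕ, 0 < δ ∧ ∀ x ∈ Γ.sublevel h n, ∀ t : ℝ, 0 ≤ t → t ≤ 1 →
      x + t • Pi.single i 1 ∈ Γ.sublevel h (n + δ) := by
  -- A point in motion lies in the full cube at `l` or at `l + E_i`, so the vectors `0` and `E_i`
  -- suffice. The `+ 1` below makes `δ` positive.
  obtain ⟨N, hN⟩ := Γ.exists_weight_add_le h n 0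
  obtain ⟨N', hN'⟩ := Γ.exists_weight_add_le h n (Pi.single i 1)
  refine ⟨(max N N' - n).toNat + 1, Nat.succ_pos _, ?_⟩
  rintro x ⟨l, I, hw, hx⟩ t h0 h1
  have hl := (Γ.chi_le_weight h l I).trans hw
  have hle : max N N' ≤ n + (((max N N' - n).toNat + 1 : ℕ) : ℤ) := by omega
  rcases add_smul_mem_cube hx i h0 h1 with hc | hc
  · refine ⟨l, Finset.univ, ?_, hc⟩
    have := hN l hl
    rw [add_zero] at this
    exact this.trans (by exact_mod_cast (le_max_left _ _).trans hle)
  · exact ⟨_, Finset.univ, (hN' l hl).trans (by exact_mod_cast (le_max_right _ _).trans hle), hc⟩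

omit [Fintype V] in
lemma incl_single (i : V) : incl (Pi.single i 1) = base i := by
  ext j
  by_cases hj : j = i <;> simp [incl, base, hj]

/-- A nonzero element of the Lipman cone pairs with some `E_i` to at most `-1`. -/
lemma exists_form_base_le_neg_one {s : Γ.dualLattice} (hs : s ∈ Γ.lipmanCone) (hs0 : s ≠ 0) :
    ∃ i, Γ.form s (base i) ≤ -1 := by
  by_contra! hcon
  -- Pairings of the dual lattice with $E_i$ are integers, so a value in $(-1,0]$ is zero; then
  -- $(s,s)=0$, against negative definiteness.
  have hz (i : V) : Γ.form s (base i) = 0 := by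
    obtain ⟨m, hm⟩ := s.2 (Pi.single i 1)
    rw [incl_single] at hm
    have h1 := hcon i
    have h2 := hs i
    rw [hm] at h1 h2 ⊢
    have h1' : -1 < m := by exact_mod_cast h1
    have h2' : m ≤ 0 := by exact_mod_cast h2
    have : m = 0 := by omega
    simp [this]
  have hne : (s : V → ℚ) ≠ 0 := fun e => hs0 (Subtype.ext e)
  have := Γ.negDef s hne
  change Γ.form s s < 0 at this
  rw [form_eq_sum] at this
  simp [hz] at this

lemma form_add_single_le {s : Γ.dualLattice} (hs : s ∈ Γ.lipmanCone) (i : V) (l : V → ℤ) :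
    Γ.form s (incl (l + Pi.single i 1)) ≤ Γ.form s (incl l) := by
  rw [map_add, map_add, incl_single]
  linarith [hs i]

lemma filt_translate {s : Γ.dualLattice} (hs : s ∈ Γ.lipmanCone) (i : V) {p : ℤ} {x : V → ℝ}
    (hx : x ∈ Γ.filt s p) {t : ℝ} (h0 : 0 ≤ t) (h1 : t ≤ 1) :
    x + t • Pi.single i 1 ∈ Γ.filt s p := by
  obtain ⟨l, I, hl, hp, hc⟩ := hx
  rcases add_smul_mem_cube hc i h0 h1 with hc | hc
  · exact ⟨l, _, hl, hp, hc⟩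
  · exact ⟨_, _, add_nonneg hl (Pi.single_nonneg.mpr zero_le_one),
      (Γ.form_add_single_le hs i l).trans hp, hc⟩

/-- At time one a cube lands exactly on a translated cube, so $(s,l)$ changes by $(s,E_i)\le-1$; at
intermediate times only preservation of the filtration is available. -/
lemma filt_translate_one {s : Γ.dualLattice} {i : V} (hi : Γ.form s (base i) ≤ -1) {p : ℤ}
    {x : V → ℝ} (hx : x ∈ Γ.filt s p) : x + Pi.single i 1 ∈ Γ.filt s (p - 1) := by
  obtain ⟨l, I, hl, hp, hc⟩ := hx
  refine ⟨_, I, add_nonneg hl (Pi.single_nonneg.mpr zero_le_one), ?_, add_single_mem_cube hc i⟩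
  rw [map_add, map_add, incl_single]
  push_cast
  linarith

omit [Fintype V] in
lemma quadrant_translate (i : V) {x : V → ℝ} (hx : x ∈ quadrant) {t : ℝ} (h0 : 0 ≤ t) :
    x + t • Pi.single i 1 ∈ quadrant := fun j =>
  add_nonneg (hx j) (mul_nonneg h0 ((Pi.single_nonneg (i := i) (α := fun _ : V => ℝ)).mpr zero_le_one j))

end ResolutionGraph

noncomputable section

/-! ### Sliding subspaces along a vector, and the resulting chain homotopies -/

section Translation

variable {E : Type} [AddCommGroup E] [Module ℝ E] [TopologicalSpace E] [ContinuousAdd E]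
  [ContinuousSMul ℝ E]

/-- The translation by `v`, as a map between subspaces. -/
def translation (v : E) {A B : Set E} (h : ∀ x ∈ A, x + v ∈ B) : TopCat.of A ⟶ TopCat.of B :=
  TopCat.ofHom ⟨fun x => ⟨x + v, h x x.2⟩, by fun_prop⟩

/-- The translation by `v`, on singular chains. -/
def chainsTranslation (v : E) {A B : Set E} (h : ∀ x ∈ A, x + v ∈ B) : chains A ⟶ chains B :=
  ((singularChainComplexFunctor AddCommGrpCat.{0}).obj (AddCommGrpCat.of ℤ)).map
    (translation v h)

omit [Module ℝ E] [ContinuousSMul ℝ E] in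
lemma chainsTranslation_comp_chainsIncl (v : E) {A B C : Set E} (h : ∀ x ∈ A, x + v ∈ B)
    (hBC : B ⊆ C) (h' : ∀ x ∈ A, x + v ∈ C) :
    chainsTranslation v h ≫ chainsIncl hBC = chainsTranslation v h' :=
  (((singularChainComplexFunctor AddCommGrpCat.{0}).obj (AddCommGrpCat.of ℤ)).map_comp
    (translation v h) (TopCat.ofHom ⟨Set.inclusion hBC, continuous_inclusion hBC⟩)).symm

omit [Module ℝ E] [ContinuousSMul ℝ E] in
lemma chainsIncl_comp_chainsTranslation (v : E) {A B C : Set E} (hAB : A ⊆ B)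
    (h : ∀ x ∈ B, x + v ∈ C) (h' : ∀ x ∈ A, x + v ∈ C) :
    chainsIncl hAB ≫ chainsTranslation v h = chainsTranslation v h' :=
  (((singularChainComplexFunctor AddCommGrpCat.{0}).obj (AddCommGrpCat.of ℤ)).map_comp
    (TopCat.ofHom ⟨Set.inclusion hAB, continuous_inclusion hAB⟩) (translation v h)).symm

/-- The set `A` can be slid inside `B` along the vector `v`. -/
def SlidesIn (v : E) (A B : Set E) : Prop :=
  ∀ x ∈ A, ∀ t : ℝ, 0 ≤ t → t ≤ 1 → x + t • v ∈ B

variable {v : E} {A B A' B' : Set E}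

omit [TopologicalSpace E] [ContinuousAdd E] [ContinuousSMul ℝ E] in
lemma SlidesIn.subset (h : SlidesIn v A B) : A ⊆ B := fun x hx => by
  simpa using h x hx 0 le_rfl zero_le_one

omit [TopologicalSpace E] [ContinuousAdd E] [ContinuousSMul ℝ E] in
lemma SlidesIn.add_mem (h : SlidesIn v A B) (x : E) (hx : x ∈ A) : x + v ∈ B := by
  simpa using h x hx 1 zero_le_one le_rfl

/-- The straight-line homotopy from the inclusion to the translation. -/
def SlidesIn.homotopy (h : SlidesIn v A B) :
    TopCat.Homotopy (X := TopCat.of A) (Y := TopCat.of B)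
      (TopCat.ofHom ⟨Set.inclusion h.subset, continuous_inclusion h.subset⟩)
      (translation v h.add_mem) where
  toFun p := ⟨(p.2 : A) + (p.1 : ℝ) • v, h _ (p.2 : A).2 _ p.1.2.1 p.1.2.2⟩
  continuous_toFun := by
    refine Continuous.subtype_mk ?_ _
    exact (continuous_subtype_val.comp continuous_snd).add
      ((continuous_subtype_val.comp continuous_fst).smul continuous_const)
  map_zero_left x := Subtype.ext (by simp)
  map_one_left x := Subtype.ext (by simp [translation])

/-- The chain homotopy from the inclusion to the translation. -/
def SlidesIn.chainHomotopy (h : SlidesIn v A B) :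
    Homotopy (chainsIncl h.subset) (chainsTranslation v h.add_mem) :=
  h.homotopy.singularChainComplexFunctorObjMap (AddCommGrpCat.of ℤ)

/-- Both homotopies are given by the same formula $x+tv$, so they commute with the inclusions on the
nose. -/
lemma SlidesIn.chainHomotopy_natural (h : SlidesIn v A B) (h' : SlidesIn v A' B') (hA : A ⊆ A')
    (hB : B ⊆ B') (i j : ℕ) :
    (chainsIncl hA).f i ≫ h'.chainHomotopy.hom i j =
      h.chainHomotopy.hom i j ≫ (chainsIncl hB).f j :=
  (singularHomotopy_natural h.homotopy h'.homotopy
    (TopCat.ofHom ⟨Set.inclusion hA, continuous_inclusion hA⟩)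
    (TopCat.ofHom ⟨Set.inclusion hB, continuous_inclusion hB⟩) (fun _ _ => rfl) _ i j).symm

/-- If a pair can be slid until the whole space lies in the target subspace, then inclusion is
zero on relative homology. -/
lemma relHomologyMap_eq_zero (h : A ⊆ B) (h' : A' ⊆ B') (hA : A ⊆ A') (hB : B ⊆ B')
    (sA : SlidesIn v A A') (sB : SlidesIn v B B') (hv : ∀ x ∈ B, x + v ∈ A') (m : ℕ) :
    relHomologyMap h h' hA hB m = 0 :=
  homologyMap_cokernelMap_eq_zero _ _ _ _ (chainsTranslation v hv) _
    (sB.chainHomotopy.trans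
      (Homotopy.ofEq (chainsTranslation_comp_chainsIncl v hv h' sB.add_mem).symm))
    (fun i j => sA.chainHomotopy.hom i j)
    -- The homotopy obtained from an equality has zero components, so only the slide contributes.
    (fun i j => by
      simpa [Homotopy.trans, Homotopy.ofEq] using sA.chainHomotopy_natural sB h h' i j) m

end Translation

/-! ### The slide applied to the filtered chains of $S_n$ -/

namespace ResolutionGraph

variable {V : Type} [Fintype V] [DecidableEq V] (Γ : ResolutionGraph V)
  (h : Γ.discriminant) (s : Γ.dualLattice)

/-- The filtered chain map induced by the inclusion of `S_n` into `S_{n'}`. -/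
def filteredInclOfLE {n n' : ℤ} (hn : n ≤ n') :
    (Γ.filteredChains h s n).Hom (Γ.filteredChains h s n') where
  f := chainsIncl (Γ.space_mono h hn)
  map_mem := by
    rintro p m _ ⟨y, rfl⟩
    exact ⟨inclOn (Γ.piece_mono h s hn le_rfl) m y,
      (inclOn_inclOn _ _ m y).trans (inclOn_inclOn _ _ m y).symm⟩

variable {h s}

/-- A chain of filtration `p` comes from the piece $S_n\cap\mathfrak X_p$. By naturality its
translate and its prism can be computed inside the pieces, which gives their filtration degrees. -/
lemma map_mem_bdry_of_slidesIn {n n' : ℤ} (hn : n ≤ n') {v : V → ℝ}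
    (hsp : SlidesIn v (Γ.space h n) (Γ.space h n'))
    (hpc : ∀ p, SlidesIn v (Γ.piece h s n p) (Γ.piece h s n' p))
    (hv : ∀ p, ∀ x ∈ Γ.piece h s n p, x + v ∈ Γ.piece h s n' (p - 1))
    {k : ℤ} (hk : 1 ≤ k) (p m : ℤ) {x : (Γ.filteredChains h s n).C.X m.toNat}
    (hx : x ∈ (Γ.filteredChains h s n).cyc k p m) :
    ((Γ.filteredInclOfLE h s hn).f.f m.toNat).hom x ∈
      (Γ.filteredChains h s n').bdry k p m := by
  refine (Γ.filteredInclOfLE h s hn).map_mem_bdry (chainsTranslation v hsp.add_mem)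
    hsp.chainHomotopy ?_ ?_ hk p m hx
  · rintro p m _ ⟨y, rfl⟩
    refine ⟨((chainsTranslation v (hv p)).f m).hom y, ?_⟩
    have e := (chainsTranslation_comp_chainsIncl v (hv p) (Γ.piece_subset_space h s n' (p - 1))
      fun x hx => hsp.add_mem x (Γ.piece_subset_space h s n p hx)).trans
      (chainsIncl_comp_chainsTranslation v (Γ.piece_subset_space h s n p) hsp.add_mem _).symm
    exact ConcreteCategory.congr_hom (congr_arg (fun φ => φ.f m) e) y
  · rintro p m m' _ ⟨y, rfl⟩
    refine ⟨((hpc p).chainHomotopy.hom m m').hom y, ?_⟩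
    exact (ConcreteCategory.congr_hom ((hpc p).chainHomotopy_natural hsp
      (Γ.piece_subset_space h s n p) (Γ.piece_subset_space h s n' p) m m') y).symm

/-! ### Powers of `U` and torsion -/

variable (h s)

/-- The class in `(E^k_{-d,q})_n` of a cycle. -/
def pageMk (k : ℤ) (i : ℤ × ℕ × ℤ)
    (c : (Γ.filteredChains h s i.1).cyc k (-(i.2.1 : ℤ)) (-(i.2.1 : ℤ) + i.2.2)) : Γ.E h s k i :=
  QuotientAddGroup.mk' _ c

lemma U_summand (k : ℤ) (i : ℤ × ℕ × ℤ) (x : Γ.E h s k i) :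
    Γ.U h s k (Γ.summand h s k i x) =
      Γ.summand h s k (i.1 + 1, i.2) (Γ.stepU h s k i x) := by
  rw [U, AddMonoidHom.coe_toIntLinearMap, summand, DirectSum.toAddMonoid_of,
    AddMonoidHom.comp_apply]

/-- The iterates of `U` are induced by the inclusions of `S_n` into `S_{n'}`. -/
lemma U_pow_summand (k : ℤ) (n : ℤ) (d : ℕ) (q : ℤ) (c) (j : ℕ) (n' : ℤ) (hn : n' = n + j) :
    (Γ.U h s k ^ j) (Γ.summand h s k (n, d, q) (Γ.pageMk h s k (n, d, q) c)) =
      Γ.summand h s k (n', d, q) (Γ.pageMk h s k (n', d, q)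
        ⟨_, (Γ.filteredInclOfLE h s (by omega : n ≤ n')).map_cyc c.2⟩) := by
  induction j generalizing n' with
  | zero =>
    obtain rfl : n' = n := by simpa using hn
    rw [pow_zero, Module.End.one_apply]
    congr 2
    refine Subtype.ext ?_
    have : chainsIncl (Γ.space_mono h (le_refl n')) = 𝟙 _ :=
      ((singularChainComplexFunctor AddCommGrpCat.{0}).obj (AddCommGrpCat.of ℤ)).map_id _
    change _ = ((chainsIncl (Γ.space_mono h (le_refl n'))).f _).hom _
    rw [this]
    rfl
  | succ j ih =>
    -- The index `n'` is free so that this substitution can identify `n + (j + 1)` with `(n + j) +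
    -- 1`, which index the summands.
    obtain rfl : n' = n + j + 1 := by push_cast at hn; omega
    rw [pow_succ', Module.End.mul_apply, ih (n + j) rfl]
    refine (Γ.U_summand h s k (n + j, d, q) _).trans ?_
    refine congr_arg (Γ.summand h s k (n + j + 1, d, q)) ?_
    refine congr_arg (Γ.pageMk h s k (n + j + 1, d, q)) (Subtype.ext ?_)
    exact inclOn_inclOn (Γ.space_mono h (by omega : n ≤ n + j))
      (Γ.space_mono h (by omega : n + j ≤ n + j + 1)) _ c.1

lemma U_pow_summand_eq_zero {k n : ℤ} {d : ℕ} {q : ℤ} {δ : ℕ}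
    (hδ : ∀ c ∈ (Γ.filteredChains h s n).cyc k (-(d : ℤ)) (-(d : ℤ) + q),
      ((Γ.filteredInclOfLE h s (by omega : n ≤ n + δ)).f.f _).hom c ∈
        (Γ.filteredChains h s (n + δ)).bdry k (-(d : ℤ)) (-(d : ℤ) + q))
    (x : Γ.E h s k (n, d, q)) : (Γ.U h s k ^ δ) (Γ.summand h s k (n, d, q) x) = 0 := by
  obtain ⟨c, rfl⟩ := QuotientAddGroup.mk'_surjective _ x
  refine (Γ.U_pow_summand h s k n d q c δ (n + δ) rfl).trans ?_
  have : Γ.pageMk h s k (n + δ, d, q)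
      ⟨_, (Γ.filteredInclOfLE h s (by omega : n ≤ n + δ)).map_cyc c.2⟩ = 0 :=
    (QuotientAddGroup.eq_zero_iff _).mpr (hδ c.1 c.2)
  rw [this, map_zero]

/-- If every homogeneous element is killed by a power of `U`, the total page is torsion. -/
lemma isTorsion_totalPage {k : ℤ} (H : ∀ n : ℤ, ∃ δ : ℕ, ∀ (d : ℕ) (q : ℤ)
    (x : Γ.E h s k (n, d, q)), (Γ.U h s k ^ δ) (Γ.summand h s k (n, d, q) x) = 0) :
    Module.IsTorsion (Polynomial ℤ) (Module.AEval' (Γ.U h s k)) := by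
  -- The exponent depends on `n`, so no uniform one is claimed; a sum is killed by the sum of the
  -- exponents of its terms.
  have key (x : Γ.totalPage h s k) : ∃ N : ℕ, (Γ.U h s k ^ N) x = 0 := by
    induction x using DirectSum.induction_on with
    | zero => exact ⟨0, map_zero _⟩
    | of i x =>
      obtain ⟨δ, hδ⟩ := H i.1
      exact ⟨δ, hδ i.2.1 i.2.2 x⟩
    | add x y hx hy =>
      obtain ⟨a, ha⟩ := hx
      obtain ⟨b, hb⟩ := hy
      refine ⟨a + b, ?_⟩
      rw [map_add, pow_add, Module.End.mul_apply, Module.End.mul_apply, hb, map_zero, add_zero,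
        ← Module.End.mul_apply, ← pow_add, add_comm, pow_add, Module.End.mul_apply, ha, map_zero]
  intro x
  obtain ⟨y, rfl⟩ := (Module.AEval'.of (Γ.U h s k)).surjective x
  obtain ⟨N, hN⟩ := key y
  refine ⟨⟨Polynomial.X ^ N, mem_nonZeroDivisors_of_ne_zero
    (pow_ne_zero _ Polynomial.X_ne_zero)⟩, ?_⟩
  change (Polynomial.X ^ N : Polynomial ℤ) • Module.AEval'.of (Γ.U h s k) y = 0
  rw [Module.AEval'.X_pow_smul_of, Module.End.smul_def, hN, map_zero]

end ResolutionGraph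

end

end FilteredLattice

theorem mainTheorem9 {V : Type} [Fintype V] [DecidableEq V]
    (Γ : FilteredLattice.ResolutionGraph V) (h : Γ.discriminant)
    (s : Γ.dualLattice) (hs : s ∈ Γ.lipmanCone) (hs0 : s ≠ 0) :
    (∀ n : ℤ, ∃ δ : ℕ, 0 < δ ∧
      (∀ (d : ℕ) (q : ℤ), (d : ℤ) ≤ q → Γ.relMap h s n δ d (q - d).toNat = 0) ∧
      (∀ k : ℤ, 1 ≤ k → ∀ (d : ℕ) (q : ℤ) (x : Γ.E h s k (n, d, q)),
        (Γ.U h s k ^ δ) (Γ.summand h s k (n, d, q) x) = 0)) ∧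
    (∀ k : ℤ, 1 ≤ k →
      Module.IsTorsion (Polynomial ℤ) (Module.AEval' (Γ.U h s k))) := by
  obtain ⟨i, hi⟩ := Γ.exists_form_base_le_neg_one hs hs0
  have main (n : ℤ) : ∃ δ : ℕ, 0 < δ ∧
      (∀ (d : ℕ) (q : ℤ), (d : ℤ) ≤ q → Γ.relMap h s n δ d (q - d).toNat = 0) ∧
      (∀ k : ℤ, 1 ≤ k → ∀ (d : ℕ) (q : ℤ) (x : Γ.E h s k (n, d, q)),
        (Γ.U h s k ^ δ) (Γ.summand h s k (n, d, q) x) = 0) := by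
    -- This `δ` is chosen before `d`, `q` and `k`: one slide serves all filtration levels and all
    -- pages.
    obtain ⟨δ, hδ0, hδ⟩ := Γ.exists_sublevel_translate h n i
    have hsp : FilteredLattice.SlidesIn (Pi.single i 1 : V → ℝ) (Γ.space h n)
        (Γ.space h (n + δ)) := fun x hx t h0 h1 =>
      ⟨hδ x hx.1 t h0 h1, FilteredLattice.ResolutionGraph.quadrant_translate i hx.2 h0⟩
    have hpc (p : ℤ) : FilteredLattice.SlidesIn (Pi.single i 1 : V → ℝ) (Γ.piece h s n p)
        (Γ.piece h s (n + δ) p) := fun x hx t h0 h1 =>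
      ⟨hδ x hx.1 t h0 h1, Γ.filt_translate hs i hx.2 h0 h1⟩
    have hv (p : ℤ) (x : V → ℝ) (hx : x ∈ Γ.piece h s n p) :
        x + Pi.single i 1 ∈ Γ.piece h s (n + δ) (p - 1) :=
      ⟨((hpc p).add_mem x hx).1, Γ.filt_translate_one hi hx.2⟩
    exact ⟨δ, hδ0,
      fun d q _ => FilteredLattice.relHomologyMap_eq_zero _ _ _ _ (hpc _) (hpc _) (hv _) _,
      fun k hk d q => Γ.U_pow_summand_eq_zero h s fun c hc =>
        Γ.map_mem_bdry_of_slidesIn (by omega) hsp hpc hv hk _ _ hc⟩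
  refine ⟨main, fun k hk => Γ.isTorsion_totalPage h s fun n => ?_⟩
  obtain ⟨δ, -, -, hδ⟩ := main n
  exact ⟨δ, hδ k hk⟩
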